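/- Let $n$ be a positive integer. A permutation $p=p_1p_2\cdots p_n$ of $\{1,\dots,n\}$ changes direction at position $i$ ($1<i<n$) if either $p_{i-1}<p_i>p_{i+1}$ or $p_{i-1}>p_i<p_{i+1}$, and $p$ has $k$ runs (alternating runs) if it changes direction at exactly $k-1$ positions. Let $R(n,k)$ be the number of permutations of $\{1,\dots,n\}$ with exactly $k$ runs, and let $R_n(x)=\sum_{k=1}^{n-1}R(n,k)x^k$. Then for every positive integer $n$ the sequence $(R(n,k))_{k\ge 0}$ is log-concave, that is, $$R(n,k-1)\,R(n,k+1)\le R(n,k)^2\qquad\text{for all } k\ge 1,$$ and likewise the sequence of coefficients of the polynomial $R_n(x)$ is log-concave. -/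

import Mathlib

namespace PermRuns

/-- The permutation `p` (in one-line notation `p 0, p 1, …, p (n - 1)`) changes direction at
position `i`: position `i` has a predecessor `a` and a successor `b`, and `p i` is either a peak
(larger than both neighbours) or a valley (smaller than both neighbours). -/
def ChangesDirectionAt {n : ℕ} (p : Equiv.Perm (Fin n)) (i : Fin n) : Prop :=
  ∃ a b : Fin n, a.val + 1 = i.val ∧ i.val + 1 = b.val ∧
    ((p a < p i ∧ p b < p i) ∨ (p i < p a ∧ p i < p b))

instance {n : ℕ} (p : Equiv.Perm (Fin n)) (i : Fin n) : Decidable (ChangesDirectionAt p i) := by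
  unfold ChangesDirectionAt
  infer_instance

/-- The number of positions at which `p` changes direction. -/
def numTurns {n : ℕ} (p : Equiv.Perm (Fin n)) : ℕ :=
  (Finset.univ.filter fun i : Fin n => ChangesDirectionAt p i).card

/-- The number of (alternating) runs of `p`: one more than the number of direction changes. -/
def numRuns {n : ℕ} (p : Equiv.Perm (Fin n)) : ℕ :=
  numTurns p + 1

/-- `R n k` is the number of permutations of length `n` with exactly `k` runs. -/
def R (n k : ℕ) : ℕ :=
  (Finset.univ.filter fun p : Equiv.Perm (Fin n) => numRuns p = k).card

/-- The run generating polynomial `R_n(x) = ∑_{k = 1}^{n - 1} R(n, k) x ^ k`. -/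
noncomputable def runPoly (n : ℕ) : Polynomial ℕ :=
  ∑ k ∈ Finset.Icc 1 (n - 1), Polynomial.C (R n k) * Polynomial.X ^ k

/-- A sequence of natural numbers is log-concave. -/
def LogConcave (a : ℕ → ℕ) : Prop :=
  ∀ k : ℕ, 1 ≤ k → a (k - 1) * a (k + 1) ≤ a k ^ 2

end PermRuns

/-! Let `T_n` be the generating polynomial of the number of turns, so that `R(n,k)` is the
coefficient of `x ^ k` in `x * T_n`. Inserting a new maximum into a word of length `n ≥ 2` with `t`
turns adds 0, 1 or 2 turns in `t + 1`, 2 and `n - 2 - t` of the positions respectively. This gives a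
first-order differential recurrence for `T_n` (`turnPoly_succ`).

The operator in it sends `x^k (1+x)^(N-k)` to a combination of only two elements of the next such
basis, so the coordinates of `T_(N+2)` obey a triangular recurrence (`turnPoly_eq`). These
coordinates are positive up to `2k ≤ N+1` and zero afterwards, and induction on `N` makes them
log-concave. Reversing `T_(N+2)` turns the expansion into `f(1+x)` with `f` nonnegative and
log-concave without internal zeros; the shift `x ↦ 1+x` preserves log-concavity
(`binomialTransform_logConcave`). -/

/-! ### Log-concave sequences and their tail sums -/

/-- Log-concavity in the strong form that excludes internal zeros. -/
def StrongLogConcave (q : ℕ → ℤ) : Prop :=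
  ∀ a s t : ℕ, q a * q (a + s + t) ≤ q (a + s) * q (a + t)

theorem strongLogConcave_of_prefix_support {q : ℕ → ℤ} (h0 : ∀ k, 0 ≤ q k)
    (hz : ∀ k, q k = 0 → q (k + 1) = 0) (hq : ∀ k, q k * q (k + 2) ≤ q (k + 1) ^ 2) :
    StrongLogConcave q := by
  have hstep : ∀ k t, q k * q (k + t + 1) ≤ q (k + 1) * q (k + t) := by
    intro k t
    induction t with
    | zero => simp [mul_comm]
    | succ t ih =>
      -- A zero at `k + t` persists to the right; otherwise `q (k + t)` can be cancelled.
      rcases (h0 (k + t)).eq_or_lt with h | h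
      · have h1 := hz _ h.symm
        have h2 := hz _ h1
        have e : k + (t + 1) + 1 = k + t + 1 + 1 := by ring
        rw [e, h2, mul_zero]
        exact mul_nonneg (h0 _) (h0 _)
      · refine le_of_mul_le_mul_left ?_ h
        have e : k + (t + 1) + 1 = k + t + 2 := by ring
        rw [e, ← add_assoc]
        have h1 := mul_le_mul_of_nonneg_left (hq (k + t)) (h0 k)
        have h2 := mul_le_mul_of_nonneg_left ih (h0 (k + t + 1))
        nlinarith
  intro a s
  induction s generalizing a with
  | zero => intro t; simp
  | succ s ih =>
    intro t
    cases t with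
    | zero => simp [mul_comm]
    | succ t =>
      have h1 := hstep a (s + t + 1)
      have h2 := ih (a + 1) t
      have e1 : a + (s + 1) + (t + 1) = a + (s + t + 1) + 1 := by ring
      have e2 : a + 1 + s + t = a + (s + t + 1) := by ring
      have e3 : a + (s + 1) = a + 1 + s := by ring
      have e4 : a + (t + 1) = a + 1 + t := by ring
      rw [e2] at h2
      rw [e1, e3, e4]
      exact h1.trans h2

/-- The sums `∑_{i ≥ j} q i` of a sequence that vanishes from `M` on. -/
def tailSum (M : ℕ) (q : ℕ → ℤ) (j : ℕ) : ℤ :=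
  ∑ i ∈ Finset.range M, q (j + i)

theorem tailSum_eq_add {M : ℕ} {q : ℕ → ℤ} (hM : ∀ j, M ≤ j → q j = 0) (j : ℕ) :
    tailSum M q j = q j + tailSum M q (j + 1) := by
  have h := Finset.sum_range_succ (fun i => q (j + i)) M
  rw [Finset.sum_range_succ', hM (j + M) (by omega)] at h
  have e : ∀ i, q (j + (i + 1)) = q (j + 1 + i) := fun i => by congr 1; ring
  simp only [e, add_zero] at h
  rw [tailSum, tailSum, ← h, add_comm]

theorem tailSum_nonneg {M : ℕ} {q : ℕ → ℤ} (h0 : ∀ j, 0 ≤ q j) (j : ℕ) : 0 ≤ tailSum M q j :=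
  Finset.sum_nonneg fun _ _ => h0 _

theorem tailSum_eq_zero {M : ℕ} {q : ℕ → ℤ} (hM : ∀ j, M ≤ j → q j = 0) (j : ℕ) (hj : M ≤ j) :
    tailSum M q j = 0 :=
  Finset.sum_eq_zero fun _ _ => hM _ (by omega)

theorem strongLogConcave_tailSum {M : ℕ} {q : ℕ → ℤ} (h0 : ∀ j, 0 ≤ q j)
    (hM : ∀ j, M ≤ j → q j = 0) (hq : StrongLogConcave q) : StrongLogConcave (tailSum M q) := by
  have hz : ∀ k, tailSum M q k = 0 → tailSum M q (k + 1) = 0 := by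
    intro k hk
    have h1 := tailSum_eq_add hM k
    have h2 := h0 k
    have h3 := tailSum_nonneg (M := M) h0 (k + 1)
    omega
  refine strongLogConcave_of_prefix_support (tailSum_nonneg h0) hz fun k => ?_
  have h1 := tailSum_eq_add hM k
  have h2 := tailSum_eq_add hM (k + 1)
  have h3 : q k * tailSum M q (k + 2) ≤ q (k + 1) * tailSum M q (k + 1) := by
    rw [tailSum, tailSum, Finset.mul_sum, Finset.mul_sum]
    refine Finset.sum_le_sum fun i _ => ?_
    have := hq k 1 (1 + i)
    rwa [show k + 1 + (1 + i) = k + 2 + i by ring, show k + (1 + i) = k + 1 + i by ring] at this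
  calc tailSum M q k * tailSum M q (k + 2)
      = q k * tailSum M q (k + 2) + tailSum M q (k + 1) * tailSum M q (k + 2) := by
        rw [h1]; ring
    _ ≤ q (k + 1) * tailSum M q (k + 1) + tailSum M q (k + 1) * tailSum M q (k + 2) := by
        gcongr
    _ = tailSum M q (k + 1) * (q (k + 1) + tailSum M q (k + 1 + 1)) := by ring
    _ = tailSum M q (k + 1) ^ 2 := by rw [← h2, sq]

/-! ### The shift `x ↦ 1 + x` preserves log-concavity -/

/-- The coefficients of `∑ j < M, q j * (1 + x) ^ j`. -/
def binomialTransform (M : ℕ) (q : ℕ → ℤ) (m : ℕ) : ℤ :=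
  ∑ j ∈ Finset.range M, (j.choose m : ℤ) * q j

theorem binomialTransform_zero (M : ℕ) (q : ℕ → ℤ) :
    binomialTransform M q 0 = tailSum M q 0 := by
  simp [binomialTransform, tailSum]

/-- Since `((1+x)^j - 1)/x = ∑_{i<j} (1+x)^i`, dropping the constant term of `f(1+x)` and dividing
by `x` replaces the coefficients of `f` by shifted tail sums. The proof is Abel summation. -/
theorem binomialTransform_succ {M : ℕ} {q : ℕ → ℤ} (hM : ∀ j, M ≤ j → q j = 0) (m : ℕ) :
    binomialTransform M q (m + 1) = binomialTransform M (fun j => tailSum M q (j + 1)) m := by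
  have habel : ∀ K, ∑ j ∈ Finset.range K, (j.choose m : ℤ) * tailSum M q (j + 1) =
      ∑ j ∈ Finset.range K, (j.choose (m + 1) : ℤ) * q j
        + (K.choose (m + 1) : ℤ) * tailSum M q K := by
    intro K
    induction K with
    | zero => simp
    | succ K ih =>
      rw [Finset.sum_range_succ, Finset.sum_range_succ, ih, tailSum_eq_add hM K,
        Nat.choose_succ_succ]
      push_cast
      ring
  rw [binomialTransform, binomialTransform, habel M, tailSum_eq_zero hM M le_rfl, mul_zero,
    add_zero]

theorem binomialTransform_logConcave {M : ℕ} {q : ℕ → ℤ} (h0 : ∀ j, 0 ≤ q j)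
    (hM : ∀ j, M ≤ j → q j = 0) (hq : StrongLogConcave q) (m : ℕ) :
    binomialTransform M q m * binomialTransform M q (m + 2) ≤ binomialTransform M q (m + 1) ^ 2 := by
  have hu := strongLogConcave_tailSum h0 hM hq
  have hM' : ∀ j, M ≤ j → tailSum M q (j + 1) = 0 :=
    fun j hj => tailSum_eq_zero hM _ (by omega)
  induction m generalizing q with
  | zero =>
    -- With `u` the tail sums, the first three coefficients are `u 0`, `∑ u (i+1)` and `∑∑ u
    -- (i+j+2)`, so the inequality can be compared term by term.
    have h2 : binomialTransform M q 2 =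
        ∑ i ∈ Finset.range M, ∑ j ∈ Finset.range M, tailSum M q (i + j + 2) := by
      rw [binomialTransform_succ hM, binomialTransform_succ hM', binomialTransform]
      simp only [Nat.choose_zero_right, Nat.cast_one, one_mul]
      refine Finset.sum_congr rfl fun i _ => ?_
      rw [tailSum]
      refine Finset.sum_congr rfl fun j _ => ?_
      congr 1
      ring
    have h1 : binomialTransform M q 1 = ∑ i ∈ Finset.range M, tailSum M q (i + 1) := by
      rw [binomialTransform_succ hM, binomialTransform]
      simp
    rw [zero_add, zero_add, h1, h2, binomialTransform_zero, sq, Finset.sum_mul_sum, Finset.mul_sum]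
    refine Finset.sum_le_sum fun i _ => ?_
    rw [Finset.mul_sum]
    refine Finset.sum_le_sum fun j _ => ?_
    have := hu 0 (i + 1) (j + 1)
    rwa [show 0 + (i + 1) + (j + 1) = i + j + 2 by ring, zero_add, zero_add] at this
  | succ m ih =>
    have hs : StrongLogConcave fun j => tailSum M q (j + 1) := by
      intro a s t
      have := hu (a + 1) s t
      rwa [show a + 1 + s + t = a + s + t + 1 by ring, show a + 1 + s = a + s + 1 by ring,
        show a + 1 + t = a + t + 1 by ring] at this
    have hn : ∀ j, 0 ≤ tailSum M q (j + 1) := fun j => tailSum_nonneg h0 _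
    rw [binomialTransform_succ hM m, show m + 1 + 2 = m + 2 + 1 by ring,
      binomialTransform_succ hM (m + 2), binomialTransform_succ hM (m + 1)]
    exact ih hn hM' hs (strongLogConcave_tailSum hn hM' hs)
      fun j hj => tailSum_eq_zero hM' _ (by omega)

/-! ### Coordinates in the basis `x^k (1+x)^(N-k)` -/

/-- The coefficients of the generating polynomial of turns of permutations of length `N + 2` in
the basis `x ^ k * (1 + x) ^ (N - k)`. -/
def turnBasisCoeff : ℕ → ℕ → ℤ
  | 0, 0 => 2
  | 0, _ + 1 => 0
  | N + 1, 0 => turnBasisCoeff N 0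
  | N + 1, k + 1 =>
    ((k : ℤ) + 2) * turnBasisCoeff N (k + 1) + ((N : ℤ) + 1 - 2 * k) * turnBasisCoeff N k

theorem turnBasisCoeff_eq_zero (N k : ℕ) (h : N + 1 < 2 * k) : turnBasisCoeff N k = 0 := by
  induction N generalizing k with
  | zero =>
    cases k with
    | zero => omega
    | succ k => rfl
  | succ N ih =>
    cases k with
    | zero => omega
    | succ k =>
      rw [turnBasisCoeff, ih (k + 1) (by omega)]
      rcases Nat.lt_or_ge (N + 1) (2 * k) with hk | hk
      · rw [ih k hk]; ring
      -- At the edge of the support the factor of the recurrence vanishes.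
      · have : (N : ℤ) + 1 - 2 * k = 0 := by omega
        rw [this]; ring

theorem turnBasisCoeff_pos (N k : ℕ) (h : 2 * k ≤ N + 1) : 0 < turnBasisCoeff N k := by
  induction N generalizing k with
  | zero =>
    obtain rfl : k = 0 := by omega
    simp [turnBasisCoeff]
  | succ N ih =>
    cases k with
    | zero => exact ih 0 (by omega)
    | succ k =>
      rw [turnBasisCoeff]
      have h2 := ih k (by omega)
      rcases Nat.lt_or_ge (N + 1) (2 * (k + 1)) with hk | hk
      · rw [turnBasisCoeff_eq_zero N _ hk]
        have : 0 < (N : ℤ) + 1 - 2 * k := by omega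
        positivity
      · have h1 := ih (k + 1) hk
        have : 0 ≤ (N : ℤ) + 1 - 2 * k := by omega
        positivity

theorem turnBasisCoeff_nonneg (N k : ℕ) : 0 ≤ turnBasisCoeff N k := by
  rcases Nat.lt_or_ge (N + 1) (2 * k) with h | h
  · exact (turnBasisCoeff_eq_zero N k h).ge
  · exact (turnBasisCoeff_pos N k h).le

theorem turnBasisCoeff_strongLogConcave (N : ℕ) : StrongLogConcave (turnBasisCoeff N) := by
  refine strongLogConcave_of_prefix_support (turnBasisCoeff_nonneg N) (fun k hk => ?_) ?_
  · refine turnBasisCoeff_eq_zero N _ ?_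
    by_contra h
    exact (turnBasisCoeff_pos N k (by omega)).ne' hk
  induction N with
  | zero =>
    intro k
    rw [turnBasisCoeff_eq_zero 0 (k + 2) (by omega), mul_zero]
    positivity
  | succ N ih =>
    have hs : StrongLogConcave (turnBasisCoeff N) := by
      refine strongLogConcave_of_prefix_support (turnBasisCoeff_nonneg N) (fun k hk => ?_) ih
      refine turnBasisCoeff_eq_zero N _ ?_
      by_contra h
      exact (turnBasisCoeff_pos N k (by omega)).ne' hk
    intro k
    rcases Nat.lt_or_ge (N + 2) (2 * (k + 2)) with hk | hk
    · rw [turnBasisCoeff_eq_zero (N + 1) (k + 2) (by omega), mul_zero]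
      positivity
    cases k with
    | zero =>
      have h := hs 0 1 1
      have p0 := turnBasisCoeff_nonneg N 0
      have p1 := turnBasisCoeff_nonneg N 1
      simp only [turnBasisCoeff, zero_add, Nat.reduceAdd] at h ⊢
      push_cast
      have hN : (2 : ℤ) ≤ N := by omega
      set a := turnBasisCoeff N 0
      set b := turnBasisCoeff N 1
      set c := turnBasisCoeff N 2
      nlinarith [mul_nonneg p0 p1, sq_nonneg (b - 2 * a), sq_nonneg a, sq_nonneg b,
        mul_nonneg (mul_nonneg p0 p1) (by omega : (0 : ℤ) ≤ N),
        mul_nonneg (mul_nonneg p0 p0) (by omega : (0 : ℤ) ≤ N)]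
    | succ k =>
      have h1 := hs k 1 1
      have h2 := hs (k + 1) 1 1
      have h3 := hs k 1 2
      have p0 := turnBasisCoeff_nonneg N k
      have p1 := turnBasisCoeff_nonneg N (k + 1)
      have p2 := turnBasisCoeff_nonneg N (k + 2)
      have p3 := turnBasisCoeff_nonneg N (k + 3)
      simp only [turnBasisCoeff, add_assoc, Nat.reduceAdd] at h1 h2 h3 ⊢
      push_cast
      obtain ⟨d, hd⟩ : ∃ d : ℤ, d = (N : ℤ) + 1 - 2 * (k + 1) := ⟨_, rfl⟩
      have hd2 : 2 ≤ d := by omega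
      have e1 : (N : ℤ) + 1 - 2 * k = d + 2 := by rw [hd]; ring
      have e2 : (N : ℤ) + 1 - 2 * ((k : ℤ) + 2) = d - 2 := by rw [hd]; ring
      rw [e1, e2, ← hd]
      have hk0 : (0 : ℤ) ≤ k := by omega
      set a := turnBasisCoeff N k
      set b := turnBasisCoeff N (k + 1)
      set c := turnBasisCoeff N (k + 2)
      set e := turnBasisCoeff N (k + 3)
      set K : ℤ := (k : ℤ)
      have i1 : (K + 2) * (K + 4) * (b * e) ≤ (K + 2) * (K + 4) * (c * c) :=
        mul_le_mul_of_nonneg_left h2 (by positivity)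
      have i2 : (d + 2) * (d - 2) * (a * c) ≤ (d + 2) * (d - 2) * (b * b) :=
        mul_le_mul_of_nonneg_left h1 (mul_nonneg (by omega) (by omega))
      have i3 : (d + 2) * (K + 4) * (a * e) ≤ (d + 2) * (K + 4) * (b * c) :=
        mul_le_mul_of_nonneg_left h3 (mul_nonneg (by omega) (by omega))
      -- After the three bounds the remaining slack is exactly `c² - 4bc + 4b² = (c - 2b)²`.
      linarith [sq_nonneg (c - 2 * b), i1, i2, i3]
-- Inserting a new maximum into a word
open Polynomial

/-- The number of direction changes met when the list `l` is appended to an entry `y` that was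
reached by an ascent (`d = true`) or by a descent (`d = false`). -/
def directionChanges : Bool → ℕ → List ℕ → ℕ
  | _, _, [] => 0
  | d, y, z :: l => (if d = decide (y < z) then 0 else 1) + directionChanges (decide (y < z)) z l

/-- The number of direction changes of a list. -/
def listTurns : List ℕ → ℕ
  | y :: z :: l => directionChanges (decide (y < z)) z l
  | _ => 0

/-- The generating polynomial of `directionChanges d y` over all insertions of `M` into `l`. -/
noncomputable def insertionPoly (M : ℕ) (d : Bool) (y : ℕ) (l : List ℕ) : ℤ[X] :=
  ((List.permutations'Aux M l).map fun l' => (X : ℤ[X]) ^ directionChanges d y l').sum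

theorem insertionPoly_cons (M : ℕ) (d : Bool) (y z : ℕ) (l : List ℕ) :
    insertionPoly M d y (z :: l) = X ^ directionChanges d y (M :: z :: l) +
      X ^ (if d = decide (y < z) then 0 else 1) * insertionPoly M (decide (y < z)) z l := by
  simp only [insertionPoly, List.permutations'Aux, List.map_cons, List.sum_cons, List.map_map,
    ← List.sum_map_mul_left]
  congr 3
  funext l'
  simp [directionChanges, pow_add]

theorem directionChanges_max {M y : ℕ} (h : y < M) (d : Bool) (z : ℕ) (l : List ℕ) (hz : z < M) :
    directionChanges d y (M :: z :: l) =
      (if d = true then 0 else 1) + 1 + directionChanges false z l := by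
  simp [directionChanges, h, hz.not_gt, add_assoc]

/-- The extra term in the ascent case is the insertion just before `y`, which makes `M` a peak
followed by a descent to `y`. Counting that slot together with those after `y` is what lets the
induction close. -/
theorem insertionPoly_eq (M : ℕ) (l : List ℕ) (hl : ∀ z ∈ l, z < M) (y : ℕ) (hy : y < M) :
    (insertionPoly M true y l + X ^ (1 + directionChanges false y l) =
      ((directionChanges true y l : ℤ[X]) + 1) * X ^ directionChanges true y l
      + X ^ (directionChanges true y l + 1)
      + ((l.length : ℤ[X]) - (directionChanges true y l : ℤ[X])) * X ^ (directionChanges true y l + 2)) ∧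
    (insertionPoly M false y l =
      (directionChanges false y l : ℤ[X]) * X ^ directionChanges false y l
      + X ^ (directionChanges false y l + 1)
      + ((l.length : ℤ[X]) - (directionChanges false y l : ℤ[X]))
        * X ^ (directionChanges false y l + 2)) := by
  induction l generalizing y with
  | nil => simp [insertionPoly, List.permutations'Aux, directionChanges, hy]
  | cons z l ih =>
    have hz : z < M := hl z (by simp)
    obtain ⟨hA, hB⟩ := ih (fun w hw => hl w (by simp [hw])) z hz
    rw [insertionPoly_cons, insertionPoly_cons, directionChanges_max hy _ _ _ hz,
      directionChanges_max hy _ _ _ hz]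
    by_cases h : y < z
    · simp only [directionChanges, h, decide_true, if_true, List.length_cons,
        Bool.false_eq_true, if_false]
      push_cast
      constructor
      · linear_combination hA
      · linear_combination X * hA
    · simp only [directionChanges, h, decide_false, if_true, List.length_cons,
        Bool.true_eq_false, Bool.false_eq_true, if_false]
      push_cast
      constructor
      · linear_combination X * hB
      · linear_combination hB

theorem sum_insertions_eq (M : ℕ) (l : List ℕ) (hl : ∀ z ∈ l, z < M) (h2 : 2 ≤ l.length) :
    ((List.permutations'Aux M l).map fun l' => (X : ℤ[X]) ^ listTurns l').sum =
      ((listTurns l : ℤ[X]) + 1) * X ^ listTurns l + 2 * X ^ (listTurns l + 1)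
      + ((l.length : ℤ[X]) - 2 - (listTurns l : ℤ[X])) * X ^ (listTurns l + 2) := by
  match l, h2 with
  | y :: z :: l, _ =>
    have hy : y < M := hl y (by simp)
    have hz : z < M := hl z (by simp)
    obtain ⟨hA, hB⟩ := insertionPoly_eq M l (fun w hw => hl w (by simp [hw])) z hz
    have hs : ((List.permutations'Aux M (y :: z :: l)).map
        fun l' => (X : ℤ[X]) ^ listTurns l').sum = X ^ directionChanges false y (z :: l)
        + (X ^ directionChanges true M (z :: l) + insertionPoly M (decide (y < z)) z l) := by
      simp only [List.permutations'Aux, List.map_cons, List.map_map, List.sum_cons, insertionPoly]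
      simp [listTurns, hy, hy.not_gt, Function.comp_def]
    rw [hs]
    have hMz : ¬ M < z := by omega
    by_cases h : y < z
    · simp only [listTurns, directionChanges, h, hMz, decide_true, decide_false, List.length_cons,
        Bool.true_eq_false, Bool.false_eq_true, if_false]
      push_cast
      linear_combination hA
    · simp only [listTurns, directionChanges, h, hMz, decide_false, List.length_cons,
        Bool.true_eq_false, if_false, if_true]
      push_cast
      linear_combination hB

/-! ### The recurrence for the turn polynomial -/

/-- The generating polynomial of the number of turns of permutations of length `n`. -/
noncomputable def turnPoly (n : ℕ) : ℤ[X] :=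
  ((List.range n).reverse.permutations'.map fun l => (X : ℤ[X]) ^ listTurns l).sum

theorem list_sum_derivative {α : Type*} (f : α → ℤ[X]) (L : List α) :
    derivative (L.map f).sum = (L.map fun a => derivative (f a)).sum := by
  induction L with
  | nil => simp
  | cons a L ih => simp [ih]

theorem turnPoly_succ (n : ℕ) (hn : 2 ≤ n) :
    turnPoly (n + 1) = (1 - X ^ 2) * derivative (X * turnPoly n)
      + (2 * X + ((n : ℤ[X]) - 1) * X ^ 2) * turnPoly n := by
  have h : ∀ l ∈ (List.range n).reverse.permutations',
      ((List.permutations'Aux n l).map fun l' => (X : ℤ[X]) ^ listTurns l').sum =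
      (1 - X ^ 2) * derivative (X * X ^ listTurns l)
      + (2 * X + ((n : ℤ[X]) - 1) * X ^ 2) * X ^ listTurns l := by
    intro l hl
    rw [List.mem_permutations'] at hl
    have hlen : l.length = n := by simpa using hl.length_eq
    rw [sum_insertions_eq n l (fun z hz => by simpa using hl.mem_iff.1 hz) (by omega), hlen,
      ← pow_succ', derivative_X_pow]
    simp only [Nat.cast_add, Nat.cast_one, map_add, map_one, map_natCast, Nat.add_sub_cancel]
    ring
  -- The reversed range puts the maximum at the head, so the recursion of `permutations'` is
  -- insertion of the maximum.
  have hr : (List.range (n + 1)).reverse = n :: (List.range n).reverse := by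
    simp [List.range_succ]
  have hf : turnPoly (n + 1) = ((List.range n).reverse.permutations'.map fun l =>
      ((List.permutations'Aux n l).map fun l' => (X : ℤ[X]) ^ listTurns l').sum).sum := by
    rw [turnPoly, hr, List.permutations']
    induction (List.range n).reverse.permutations' with
    | nil => simp
    | cons a L ih => simp [ih]
  rw [hf, List.map_congr_left h, List.sum_map_add, List.sum_map_mul_left, List.sum_map_mul_left,
    ← list_sum_derivative, List.sum_map_mul_left, turnPoly]

theorem sum_range_shift {A : Type*} [AddCommMonoid A] (f : ℕ → A) (n : ℕ) (hf : f n = 0) :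
    ∑ k ∈ Finset.range n, f k = ∑ k ∈ Finset.range n, f (k + 1) + f 0 := by
  rw [← Finset.sum_range_succ', Finset.sum_range_succ, hf, add_zero]

theorem turnPoly_eq (N : ℕ) : turnPoly (N + 2) =
    ∑ k ∈ Finset.range (N + 1), C (turnBasisCoeff N k) * (X ^ k * (1 + X) ^ (N - k)) := by
  induction N with
  | zero =>
    simp [turnPoly, turnBasisCoeff, List.range_succ, List.permutations', List.permutations'Aux,
      listTurns, directionChanges]
    norm_num
  | succ N ih =>
    have hbasis : ∀ k ∈ Finset.range (N + 1),
        (1 - X ^ 2) * derivative (X * (X ^ k * (1 + X) ^ (N - k)))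
        + (2 * X + ((N : ℤ[X]) + 1) * X ^ 2) * (X ^ k * (1 + X) ^ (N - k)) =
        ((k : ℤ[X]) + 1) * (X ^ k * (1 + X) ^ (N + 1 - k))
        + ((N : ℤ[X]) + 1 - 2 * (k : ℤ[X])) * (X ^ (k + 1) * (1 + X) ^ (N - k)) := by
      intro k hk
      obtain ⟨m, rfl⟩ : ∃ m, N = k + m := ⟨N - k, by simp at hk; omega⟩
      rw [show k + m - k = m by omega, show k + m + 1 - k = m + 1 by omega, ← mul_assoc,
        ← pow_succ']
      cases m with
      | zero => simp; ring
      | succ m =>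
        simp only [derivative_mul, derivative_pow, derivative_one, derivative_X, Nat.add_sub_cancel, Nat.cast_add, Nat.cast_one, map_add,
          map_one, map_natCast]
        ring
    have hlhs : turnPoly (N + 1 + 2) = ∑ k ∈ Finset.range (N + 1),
        (C (((k : ℤ) + 1) * turnBasisCoeff N k) * (X ^ k * (1 + X) ^ (N + 1 - k))
        + C (((N : ℤ) + 1 - 2 * k) * turnBasisCoeff N k)
          * (X ^ (k + 1) * (1 + X) ^ (N - k))) := by
      rw [show N + 1 + 2 = N + 2 + 1 by ring, turnPoly_succ _ (by omega), ih, Finset.mul_sum,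
        derivative_sum, Finset.mul_sum, Finset.mul_sum, ← Finset.sum_add_distrib]
      refine Finset.sum_congr rfl fun k hk => ?_
      have h := hbasis k hk
      rw [mul_left_comm X, derivative_C_mul]
      simp only [map_mul, map_add, map_sub, map_one, map_natCast, map_ofNat, Nat.cast_add,
        Nat.cast_ofNat]
      linear_combination C (turnBasisCoeff N k) * h
    have hlast : turnBasisCoeff N (N + 1) = 0 := turnBasisCoeff_eq_zero N _ (by omega)
    rw [hlhs, Finset.sum_range_succ' _ (N + 1), Finset.sum_add_distrib]
    have h1 := sum_range_shift (fun k => C (((k : ℤ) + 1) * turnBasisCoeff N k)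
      * ((X : ℤ[X]) ^ k * (1 + X) ^ (N + 1 - k))) (N + 1) (by simp only [hlast]; simp)
    rw [h1, add_right_comm, ← Finset.sum_add_distrib]
    congr 1
    · refine Finset.sum_congr rfl fun k _ => ?_
      rw [Nat.add_sub_add_right, turnBasisCoeff, ← add_mul, ← map_add, Nat.cast_succ, add_assoc,
        one_add_one_eq_two]
    · simp [turnBasisCoeff]

/-- Reading coefficients from degree `N` down turns `x^k (1+x)^(N-k)` into `(1+x)^(N-k)`. -/
theorem coeff_turnPoly (N i : ℕ) (hi : i ≤ N) : (turnPoly (N + 2)).coeff i =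
    binomialTransform (N + 1) (fun j => if j ≤ N then turnBasisCoeff N (N - j) else 0) (N - i) := by
  rw [turnPoly_eq, finsetSum_coeff, binomialTransform, ← Finset.sum_range_reflect]
  refine Finset.sum_congr rfl fun j hj => ?_
  have hj' : j ≤ N := by simp at hj; omega
  rw [if_pos hj', show N + 1 - 1 - j = N - j by omega, show N - (N - j) = j by omega, coeff_C_mul,
    coeff_X_pow_mul', mul_comm]
  split_ifs with h
  · rw [coeff_one_add_X_pow]
    congr 2
    rw [← Nat.choose_symm (by omega)]
    congr 1
    omega
  · rw [Nat.choose_eq_zero_of_lt (by omega)]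
    simp

theorem coeff_turnPoly_eq_zero (N i : ℕ) (hi : N < i) : (turnPoly (N + 2)).coeff i = 0 := by
  rw [turnPoly_eq, finsetSum_coeff]
  refine Finset.sum_eq_zero fun k hk => ?_
  rw [coeff_C_mul, coeff_X_pow_mul']
  split_ifs with h
  · rw [coeff_one_add_X_pow, Nat.choose_eq_zero_of_lt (by simp at hk; omega)]
    simp
  · simp

theorem turnPoly_logConcave (N i : ℕ) : (turnPoly (N + 2)).coeff i * (turnPoly (N + 2)).coeff (i + 2)
    ≤ (turnPoly (N + 2)).coeff (i + 1) ^ 2 := by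
  rcases Nat.lt_or_ge N (i + 2) with h | h
  · rw [coeff_turnPoly_eq_zero N _ h, mul_zero]
    positivity
  have h0 := turnBasisCoeff_nonneg N
  rw [coeff_turnPoly N i (by omega), coeff_turnPoly N (i + 1) (by omega), coeff_turnPoly N _ h,
    show N - i = N - (i + 2) + 2 by omega, show N - (i + 1) = N - (i + 2) + 1 by omega, mul_comm]
  refine binomialTransform_logConcave (fun j => ?_) (fun j hj => if_neg (by omega)) ?_ _
  · split_ifs
    exacts [h0 _, le_rfl]
  · intro a s t
    dsimp only
    by_cases hN : a + s + t ≤ N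
    · rw [if_pos hN, if_pos (by omega), if_pos (by omega), if_pos (by omega)]
      have := turnBasisCoeff_strongLogConcave N (N - (a + s + t)) s t
      rwa [show N - (a + s + t) + s + t = N - a by omega,
        show N - (a + s + t) + s = N - (a + t) by omega,
        show N - (a + s + t) + t = N - (a + s) by omega, mul_comm,
        mul_comm (turnBasisCoeff N (N - (a + t)))] at this
    · rw [if_neg hN, mul_zero]
      split_ifs <;> first | exact mul_nonneg (h0 _) (h0 _) | simp

/-! ### From permutations to lists -/

/-- The function `f` has a peak or a valley at `i`. -/
def IsTurn {n : ℕ} (f : Fin n → ℕ) (i : Fin n) : Prop :=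
  ∃ a b : Fin n, a.val + 1 = i.val ∧ i.val + 1 = b.val ∧
    ((f a < f i ∧ f b < f i) ∨ (f i < f a ∧ f i < f b))

theorem not_isTurn_zero {n : ℕ} (f : Fin (n + 1) → ℕ) : ¬ IsTurn f 0 := by
  rintro ⟨a, b, h, -⟩
  simp at h

theorem isTurn_succ_succ {n : ℕ} (f : Fin (n + 2) → ℕ) (i : Fin n) :
    IsTurn f i.succ.succ ↔ IsTurn (fun j => f j.succ) i.succ := by
  constructor
  · rintro ⟨a, b, ha, hb, h⟩
    have ha0 : a ≠ 0 := by rintro rfl; simp at ha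
    have hb0 : b ≠ 0 := by rintro rfl; simp at hb
    obtain ⟨a, rfl⟩ := Fin.exists_succ_eq.2 ha0
    obtain ⟨b, rfl⟩ := Fin.exists_succ_eq.2 hb0
    exact ⟨a, b, by simpa using ha, by simpa using hb, h⟩
  · rintro ⟨a, b, ha, hb, h⟩
    exact ⟨a.succ, b.succ, by simpa using ha, by simpa using hb, h⟩

theorem isTurn_succ_zero {n : ℕ} (f : Fin (n + 3) → ℕ) (hf : Function.Injective f) :
    IsTurn f (Fin.succ 0) ↔ ¬ (decide (f 0 < f 1) = decide (f 1 < f 2)) := by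
  have h01 : f 0 ≠ f 1 := fun h => by simpa using hf h
  have hv : ((2 : Fin (n + 3)) : ℕ) = 2 := Nat.mod_eq_of_lt (show 2 < n + 3 by omega)
  have h12 : f 1 ≠ f 2 := fun h => by
    have := congrArg Fin.val (hf h)
    rw [hv] at this
    simp at this
  have hiff : IsTurn f (Fin.succ 0) ↔ (f 0 < f 1 ∧ f 2 < f 1) ∨ (f 1 < f 0 ∧ f 1 < f 2) := by
    constructor
    · rintro ⟨a, b, ha, hb, h⟩
      obtain rfl : a = 0 := Fin.ext (by simpa using ha)
      obtain rfl : b = 2 := Fin.ext (hb.symm.trans (by rw [hv]; simp))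
      exact h
    · exact fun h => ⟨0, 2, by simp, by rw [hv]; simp, h⟩
  rw [hiff, decide_eq_decide]
  omega

open Classical in
theorem card_isTurn_eq (n : ℕ) (f : Fin n → ℕ) (hf : Function.Injective f) :
    (Finset.univ.filter fun i : Fin n => IsTurn f i).card = listTurns (List.ofFn f) := by
  rw [Finset.card_filter]
  induction n with
  | zero => simp [listTurns]
  | succ n ih =>
    have ih' := ih (fun i => f i.succ) fun i j h => Fin.succ_injective _ (hf h)
    rw [Fin.sum_univ_succ, if_neg (not_isTurn_zero f), zero_add]
    match n, f, hf, ih' with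
    | 0, f, hf, _ => simp [listTurns]
    | 1, f, hf, _ =>
      simp only [Finset.univ_unique, Fin.default_eq_zero, Finset.sum_singleton]
      rw [if_neg]
      · simp [List.ofFn_succ, listTurns, directionChanges]
      · rintro ⟨a, b, -, h, -⟩
        have := b.2
        simp at h
        omega
    | n + 2, f, hf, ih' =>
      have hl : listTurns (List.ofFn f) =
          (if decide (f 0 < f 1) = decide (f 1 < f 2) then 0 else 1)
          + listTurns (List.ofFn fun i => f i.succ) := by
        simp [List.ofFn_succ, listTurns, directionChanges]
      rw [hl, ← ih', Fin.sum_univ_succ, Fin.sum_univ_succ (fun i => if IsTurn _ i then 1 else 0),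
        if_neg (not_isTurn_zero fun i => f i.succ), zero_add]
      congr 1
      · simp only [isTurn_succ_zero f hf, ite_not]
      · exact Finset.sum_congr rfl fun i _ => by simp only [isTurn_succ_succ]

theorem numTurns_eq {n : ℕ} (p : Equiv.Perm (Fin n)) :
    PermRuns.numTurns p = listTurns (List.ofFn fun i => (p i : ℕ)) := by
  classical
  rw [← card_isTurn_eq n (fun i => (p i : ℕ)) fun i j h => p.injective (Fin.ext h),
    PermRuns.numTurns]
  congr 1
  exact Finset.filter_congr fun i _ => Iff.rfl

theorem sum_perm_eq_sum_permutations {A : Type*} [AddCommMonoid A] (n : ℕ) (F : List ℕ → A) :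
    ∑ p : Equiv.Perm (Fin n), F (List.ofFn fun i => (p i : ℕ)) =
      ((List.range n).reverse.permutations'.map F).sum := by
  have hnd : (List.range n).reverse.permutations'.Nodup :=
    (List.permutations_perm_permutations' _).nodup_iff.1 <| List.nodup_permutations _ <| (List.nodup_reverse.2 List.nodup_range)
  rw [← List.sum_toFinset F hnd]
  refine Finset.sum_bij (fun p _ => List.ofFn fun i => (p i : ℕ)) ?_ ?_ ?_ fun _ _ => rfl
  · intro p _
    rw [List.mem_toFinset, List.mem_permutations', List.perm_ext_iff_of_nodup
      (List.nodup_ofFn.2 fun i j h => p.injective (Fin.ext h))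
      (List.nodup_reverse.2 List.nodup_range)]
    intro a
    simp only [List.mem_ofFn, List.mem_reverse, List.mem_range]
    constructor
    · rintro ⟨i, rfl⟩
      exact (p i).2
    · intro h
      exact ⟨p.symm ⟨a, h⟩, by simp⟩
  · intro p _ q _ h
    ext i
    exact congrFun (List.ofFn_injective h) i
  · intro l hl
    rw [List.mem_toFinset, List.mem_permutations'] at hl
    have hlen : l.length = n := by simpa using hl.length_eq
    subst hlen
    have hlt : ∀ i : Fin l.length, l.get i < l.length := fun i => by
      simpa using hl.mem_iff.1 (l.get_mem i)
    have hln : l.Nodup := hl.nodup_iff.2 (List.nodup_reverse.2 List.nodup_range)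
    have hinj : Function.Injective fun i : Fin l.length => (⟨l.get i, hlt i⟩ : Fin l.length) :=
      fun i j h => List.nodup_iff_injective_get.1 hln (congrArg Fin.val h)
    exact ⟨Equiv.ofBijective _ (Finite.injective_iff_bijective.1 hinj), Finset.mem_univ _,
      List.ofFn_get l⟩

/-! ### Log-concavity of the run numbers -/

theorem R_eq_coeff (n k : ℕ) : (PermRuns.R n k : ℤ) = (X * turnPoly n).coeff k := by
  rw [turnPoly, ← sum_perm_eq_sum_permutations n fun l => (X : ℤ[X]) ^ listTurns l,
    Finset.mul_sum, finsetSum_coeff, PermRuns.R, Finset.card_filter]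
  push_cast
  refine Finset.sum_congr rfl fun p _ => ?_
  rw [← numTurns_eq, ← pow_succ', coeff_X_pow, PermRuns.numRuns]
  simp only [eq_comm]

theorem R_zero (n : ℕ) : PermRuns.R n 0 = 0 := by
  have h := R_eq_coeff n 0
  simpa using h

theorem R_one (k : ℕ) : PermRuns.R 1 k = if k = 1 then 1 else 0 := by
  have h := R_eq_coeff 1 k
  have h1 : turnPoly 1 = 1 := by
    simp [turnPoly, List.range_succ, List.permutations', List.permutations'Aux, listTurns]
  rw [h1, mul_one, coeff_X] at h
  simp only [eq_comm (a := 1)] at h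
  exact_mod_cast h

theorem R_succ (N i : ℕ) : (PermRuns.R (N + 2) (i + 1) : ℤ) = (turnPoly (N + 2)).coeff i := by
  rw [R_eq_coeff, coeff_X_mul]

theorem R_eq_zero (N k : ℕ) (hk : N + 1 < k) : PermRuns.R (N + 2) k = 0 := by
  obtain ⟨i, rfl⟩ : ∃ i, k = i + 1 := ⟨k - 1, by omega⟩
  have h := R_succ N i
  rw [coeff_turnPoly_eq_zero N i (by omega)] at h
  exact_mod_cast h

theorem R_logConcave (n : ℕ) (hn : 1 ≤ n) : PermRuns.LogConcave (fun k => PermRuns.R n k) := by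
  intro k hk
  obtain ⟨k, rfl⟩ : ∃ j, k = j + 1 := ⟨k - 1, by omega⟩
  simp only [Nat.add_sub_cancel]
  obtain rfl | ⟨N, rfl⟩ : n = 1 ∨ ∃ N, n = N + 2 := by
    rcases Nat.lt_or_ge n 2 with h | h
    · exact Or.inl (by omega)
    · exact Or.inr ⟨n - 2, by omega⟩
  · rw [R_one (k + 1 + 1), if_neg (by omega), mul_zero]
    exact Nat.zero_le _
  · cases k with
    | zero => simp [R_zero]
    | succ k =>
      have h := turnPoly_logConcave N k
      rw [← R_succ, ← R_succ, ← R_succ] at h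
      exact_mod_cast h

theorem coeff_runPoly (n k : ℕ) :
    (PermRuns.runPoly n).coeff k = if k ∈ Finset.Icc 1 (n - 1) then PermRuns.R n k else 0 := by
  simp [PermRuns.runPoly, finsetSum_coeff, coeff_X_pow]

theorem theorem3 (n : ℕ) (hn : 1 ≤ n) :
    PermRuns.LogConcave (fun k => PermRuns.R n k) ∧
      PermRuns.LogConcave (fun k => (PermRuns.runPoly n).coeff k) := by
  refine ⟨R_logConcave n hn, ?_⟩
  obtain rfl | ⟨N, rfl⟩ : n = 1 ∨ ∃ N, n = N + 2 := by
    rcases Nat.lt_or_ge n 2 with h | h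
    · exact Or.inl (by omega)
    · exact Or.inr ⟨n - 2, by omega⟩
  -- Here `runPoly 1 = 0`, an empty sum, although `R 1 1 = 1`.
  · intro k _
    simp [PermRuns.runPoly]
  · have hc : (fun k => (PermRuns.runPoly (N + 2)).coeff k) = fun k => PermRuns.R (N + 2) k := by
      funext k
      rw [coeff_runPoly]
      split_ifs with h
      · rfl
      · rw [Finset.mem_Icc] at h
        rcases Nat.eq_zero_or_pos k with rfl | hk
        · exact (R_zero _).symm
        · exact (R_eq_zero N k (by omega)).symm
    rw [hc]
    exact R_logConcave _ hn
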